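/- An xor-clause is an equation $x_1\oplus\dots\oplus x_k\equiv p$ with distinct Boolean variables $x_1,\dots,x_k$ and $p\in\{\bot,\top\}$; a literal $x$ or $\neg x$ is identified with the clause $x\equiv\top$ or $x\equiv\bot$, and $\bot$ also denotes the empty clause $()\equiv\top$. Let $\varphi$ be a finite conjunction of xor-clauses in 3-xor normal form: every clause has exactly three variables, and any two distinct clauses share at most one variable. An xor-cycle in $\varphi$ consists of $n\ge 2$ distinct variables $x_1,\dots,x_n$ (inner variables), variables $y_1,\dots,y_n$ (outer variables) and $n$ distinct clauses of $\varphi$ of the form $x_1\oplus x_2\oplus y_1\equiv p_1$, $\dots$, $x_{n-1}\oplus x_n\oplus y_{n-1}\equiv p_{n-1}$, $x_1\oplus x_n\oplus y_n\equiv p_n$. Suppose that $\varphi$ is cycle-partitionable: the variables of $\varphi$ can be partitioned into two (possibly empty) sets $V_{\mathrm{in}},V_{\mathrm{out}}$ such that for every xor-cycle in $\varphi$ all inner variables lie in $V_{\mathrm{in}}$ and all outer variables lie in $V_{\mathrm{out}}$. Then $\varphi$ is Subst-deducible and EC-deducible, where $\varphi$ is called $S$-deducible for a deduction system $S$ if for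 all literals $\tilde l_1,\dots,\tilde l_k$ over the variables of $\varphi$, writing $\psi=\varphi\wedge\tilde l_1\wedge\dots\wedge\tilde l_k$: (i) if $\psi$ is unsatisfiable, then $\bot$ is $S$-derivable from $\psi$; (ii) if $\psi$ is satisfiable, then every literal over the variables of $\varphi$ that is a logical consequence of $\psi$ is $S$-derivable from $\psi$. Here a clause is $S$-derivable from $\psi$ if it is obtained from clauses of $\psi$ by finitely many applications of the rules of $S$. Writing $C[x/E]$ for the result of replacing the variable $x$ in $C$ by $E$ and normalizing ($C[x/E]=C$ if $x$ does not occur in $C$), the rules of Subst are: from $x$ and $C$ infer $C[x/\top]$; from $\neg x$ and $C$ infer $C[x/\bot]$; from $x\oplus y\equiv\bot$ and $C$ infer $C[x/y]$; from $x\oplus y\equiv\top$ and $C$ infer $C[x/(y\oplus\top)]$. The rules of EC are: from $x$ and $\neg x$ infer $\bot$; from $x\equiv p$ and $x\oplus y\equiv q$ infer $y\equiv p\oplus q$; from $x\equiv p$ and $x\oplus y\oplus z\equiv q$ infer $y\oplus z\equiv p\oplus q$; from $x_1\oplus x_2\equiv p_1,\ \dots,\ x_{n-1}\oplus x_n\equiv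 p_{n-1}$ and $x_1\oplus x_n\oplus y\equiv q$ infer $y\equiv p_1\oplus\dots\oplus p_{n-1}\oplus q$; from $x_1\oplus x_2\equiv p_1,\ \dots,\ x_{n-1}\oplus x_n\equiv p_{n-1},\ x_n\oplus x_1\equiv p_n$ with $p_1\oplus\dots\oplus p_n=\top$ infer $\bot$. (Variables displayed in one clause are distinct.) -/

import Mathlib

namespace XorReasoning

/-- An xor-clause in normal form over the variables `V`, in equation form:
`x₁ ⊕ ⋯ ⊕ x_k ≡ rhs`, where `vars = {x₁, …, x_k}` and `1 : ZMod 2` is "true".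
(So the expression `x₁ ⊕ ⋯ ⊕ x_k` is the clause with `rhs = 1`, and
`x₁ ⊕ ⋯ ⊕ x_k ⊕ ⊤` is the clause with `rhs = 0`.) -/
@[ext]
structure XorClause (V : Type*) where
  vars : Finset V
  rhs : ZMod 2

/-- A (finite) conjunction of xor-clauses. -/
abbrev XorConj (V : Type*) := Finset (XorClause V)

variable {V : Type*} [DecidableEq V]

instance : DecidableEq (XorClause V) := fun C D =>
  decidable_of_iff (C.vars = D.vars ∧ C.rhs = D.rhs) XorClause.ext_iff.symm

namespace XorClause

/-- A total truth assignment `τ` satisfies an xor-clause. -/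
def Sat (τ : V → ZMod 2) (C : XorClause V) : Prop :=
  ∑ x ∈ C.vars, τ x = C.rhs

/-- The literal `x` (for `b = 1`) or `¬ x` (for `b = 0`), i.e. the clause `x ≡ b`. -/
def lit (x : V) (b : ZMod 2) : XorClause V := ⟨{x}, b⟩

/-- The empty xor-clause `()`, a synonym for `⊥`: in equation form `0 ≡ 1`. -/
def bot : XorClause V := ⟨∅, 1⟩

/-- The normal form of the clause obtained from `C` by substituting the variable `x`
with the expression `w₁ ⊕ ⋯ ⊕ w_m ⊕ c`, where `W = {w₁, …, w_m}` and `c` is a constant. -/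
def subst (C : XorClause V) (x : V) (W : Finset V) (c : ZMod 2) : XorClause V :=
  if x ∈ C.vars then ⟨symmDiff (C.vars.erase x) W, C.rhs + c⟩ else C

end XorClause

namespace XorConj

/-- The variables occurring in a conjunction. -/
def vars (φ : XorConj V) : Finset V := φ.biUnion XorClause.vars

/-- The literals over the variables of a conjunction. -/
def lits (φ : XorConj V) : Set (XorClause V) :=
  {l | ∃ x ∈ vars φ, ∃ b : ZMod 2, l = XorClause.lit x b}

def Satisfiable (φ : XorConj V) : Prop :=
  ∃ τ : V → ZMod 2, ∀ C ∈ φ, C.Sat τ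

/-- `D` is a logical consequence of `φ`. -/
def Entails (φ : XorConj V) (D : XorClause V) : Prop :=
  ∀ τ : V → ZMod 2, (∀ C ∈ φ, C.Sat τ) → D.Sat τ

end XorConj

/-- A deduction system: `R P D` means that some inference rule has the set of premises `P`
and the conclusion `D`. -/
abbrev DeductionSystem (V : Type*) := Set (XorClause V) → XorClause V → Prop

/-- `Derivable R ψ D`: the clause `D` occurs in a derivation from `ψ` in the system `R`. -/
inductive Derivable (R : DeductionSystem V) (ψ : XorConj V) : XorClause V → Prop
  | mem {D : XorClause V} : D ∈ ψ → Derivable R ψ D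
  | step {P : Set (XorClause V)} {D : XorClause V} :
      R P D → (∀ E ∈ P, Derivable R ψ E) → Derivable R ψ D

/-- The rules of unit propagation `UP`. -/
inductive UPRule : DeductionSystem V
  /-- from `x` and `C` infer `C[x / ⊤]` -/
  | unitPos (x : V) (C : XorClause V) :
      UPRule {XorClause.lit x 1, C} (C.subst x ∅ 1)
  /-- from `x ⊕ ⊤` and `C` infer `C[x / ⊥]` -/
  | unitNeg (x : V) (C : XorClause V) :
      UPRule {XorClause.lit x 0, C} (C.subst x ∅ 0)

/-- The rules of `Subst`: those of `UP` and two substitution rules. -/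
inductive SubstRule : DeductionSystem V
  | up {P : Set (XorClause V)} {D : XorClause V} : UPRule P D → SubstRule P D
  /-- from `x ⊕ y ⊕ ⊤` and `C` infer `C[x / y]` -/
  | eqvPos (x y : V) (C : XorClause V) : x ≠ y →
      SubstRule {⟨{x, y}, 0⟩, C} (C.subst x {y} 0)
  /-- from `x ⊕ y` and `C` infer `C[x / y ⊕ ⊤]` -/
  | eqvNeg (x y : V) (C : XorClause V) : x ≠ y →
      SubstRule {⟨{x, y}, 1⟩, C} (C.subst x {y} 1)

/-- The rules of `EC`, in equation form. The side conditions `≠` say that the clauses in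
the rules are in normal form with the displayed number of variables. -/
inductive ECRule : DeductionSystem V
  /-- from `x` and `¬ x` infer `⊥` -/
  | conflict (x : V) : ECRule {XorClause.lit x 1, XorClause.lit x 0} XorClause.bot
  /-- from `x ≡ p` and `x ⊕ y ≡ q` infer `y ≡ p ⊕ q` -/
  | unit2 (x y : V) (p q : ZMod 2) : x ≠ y →
      ECRule {XorClause.lit x p, ⟨{x, y}, q⟩} (XorClause.lit y (p + q))
  /-- from `x ≡ p` and `x ⊕ y ⊕ z ≡ q` infer `y ⊕ z ≡ p ⊕ q` -/
  | unit3 (x y z : V) (p q : ZMod 2) : x ≠ y → x ≠ z → y ≠ z →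
      ECRule {XorClause.lit x p, ⟨{x, y, z}, q⟩} ⟨{y, z}, p + q⟩
  /-- from `x₀ ⊕ x₁ ≡ p₀`, …, `x_{n-1} ⊕ x_n ≡ p_{n-1}` and `x₀ ⊕ x_n ⊕ y ≡ q`
  infer `y ≡ p₀ ⊕ ⋯ ⊕ p_{n-1} ⊕ q` -/
  | xorImply (n : ℕ) (x : Fin (n + 1) → V) (p : Fin n → ZMod 2) (y : V) (q : ZMod 2) :
      (∀ i : Fin n, x i.castSucc ≠ x i.succ) →
      x 0 ≠ x (Fin.last n) → y ≠ x 0 → y ≠ x (Fin.last n) →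
      ECRule
        (insert ⟨{x 0, x (Fin.last n), y}, q⟩
          (Set.range fun i : Fin n => (⟨{x i.castSucc, x i.succ}, p i⟩ : XorClause V)))
        (XorClause.lit y (∑ i, p i + q))
  /-- from `x₁ ⊕ x₂ ≡ p₁`, …, `x_{n-1} ⊕ x_n ≡ p_{n-1}`, `x_n ⊕ x₁ ≡ p_n`
  infer `⊥` if `p₁ ⊕ ⋯ ⊕ p_n = ⊤`; here `finRotate n` is the cyclic successor on `Fin n` -/
  | xorConflict (n : ℕ) (x : Fin n → V) (p : Fin n → ZMod 2) :
      (∀ i : Fin n, x i ≠ x (finRotate n i)) →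
      ∑ i, p i = 1 →
      ECRule
        (Set.range fun i : Fin n => (⟨{x i, x (finRotate n i)}, p i⟩ : XorClause V))
        XorClause.bot

/-- `φ` is `R`-deducible: under every finite set `A` of assumption literals over its
variables, the system derives `⊥` if `φ ∧ A` is unsatisfiable, and otherwise derives
every literal over the variables of `φ` that is implied by `φ ∧ A`. -/
def Deducible (R : DeductionSystem V) (φ : XorConj V) : Prop :=
  ∀ A : Finset (XorClause V), (∀ l ∈ A, l ∈ XorConj.lits φ) →
    (¬ XorConj.Satisfiable (φ ∪ A) → Derivable R (φ ∪ A) XorClause.bot) ∧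
    (XorConj.Satisfiable (φ ∪ A) →
      ∀ l ∈ XorConj.lits φ, XorConj.Entails (φ ∪ A) l → Derivable R (φ ∪ A) l)

def SubstDeducible (φ : XorConj V) : Prop := Deducible SubstRule φ

def ECDeducible (φ : XorConj V) : Prop := Deducible ECRule φ

/-- 3-xor normal form. -/
def IsThreeXorNF (φ : XorConj V) : Prop :=
  (∀ C ∈ φ, C.vars.card = 3) ∧
  (∀ C ∈ φ, ∀ D ∈ φ, C ≠ D → (C.vars ∩ D.vars).card ≤ 1)

/-- The `i`-th clause `x_i ⊕ x_{i+1} ⊕ y_i ≡ p_i` (indices cyclic) of the xor-cycle with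
inner variables `x`, outer variables `y` and parities `p`. -/
def cycleClause {n : ℕ} (x y : Fin n → V) (p : Fin n → ZMod 2) (i : Fin n) : XorClause V :=
  ⟨{x i, x (finRotate n i), y i}, p i⟩

/-- `x₁, …, x_n` are the inner and `y₁, …, y_n` the outer variables of an xor-cycle in `φ`.
The variables `x_i` are distinct and so are the `n` clauses, so that they form a genuine
cycle of the constraint graph; the `y_i` are only required to differ from the two inner
variables in their clause. -/
structure IsXorCycleIn (φ : XorConj V) {n : ℕ} (x y : Fin n → V) (p : Fin n → ZMod 2) :
    Prop where
  two_le : 2 ≤ n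
  inner_injective : Function.Injective x
  outer_ne : ∀ i, y i ≠ x i ∧ y i ≠ x (finRotate n i)
  clause_injective : Function.Injective (cycleClause x y p)
  clause_mem : ∀ i, cycleClause x y p i ∈ φ

/-- The variables of `φ` can be partitioned into `Vin` and `Vout` (possibly empty) such that,
for every xor-cycle in `φ`, the inner variables are in `Vin` and the outer ones in `Vout`. -/
def IsCyclePartitionable (φ : XorConj V) : Prop :=
  ∃ Vin Vout : Finset V, Disjoint Vin Vout ∧ Vin ∪ Vout = XorConj.vars φ ∧
    ∀ (n : ℕ) (x y : Fin n → V) (p : Fin n → ZMod 2), IsXorCycleIn φ x y p →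
      (∀ i, x i ∈ Vin) ∧ (∀ i, y i ∈ Vout)

end XorReasoning

/-! Removing a clause `c` of `φ` must disconnect one of its variables from the other two. Otherwise
all three stay mutually connected, each connected pair closes up with `c` to an xor-cycle whose
outer variable is the third one, and some variable is both inner and outer. The component of the
isolated variable is a cut for `c` (`IsCyclePartitionable.exists_cut`). A parity system in which
every hyperedge has a cut is solvable for all right-hand sides, even with one variable prescribed
(`exists_parity_solution`): an extremal cut lets one repair its own equation without disturbing the
others. Let `T` be the set of derivable clauses. If it does not contain ⊥, then for both systems it
is `Saturated`. Merge variables linked by clauses of `φ` with a determined variable. The clauses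
without determined variables then still have three distinct vertices each, and the cuts survive.
Solving that system gives a model of `φ` that agrees with all literals of `T` and takes any desired
value at one undetermined variable (`Saturated.exists_model`). So a set that does not derive ⊥ is
satisfiable, and an underivable literal is not implied. -/

namespace XorReasoning

/-! ### Cuts in hypergraphs and solvability of parity systems -/

/-- `D` is a cut for the hyperedge `i` of the hypergraph with edges `e j`, `j ∈ S`: it separates
exactly one vertex of `e i` from the others, and it does not split any other edge. -/
structure IsCut {ι K : Type*} (S : Finset ι) (e : ι → Finset K) (i : ι) (D : Set K) : Prop where
  meets : ∃ d ∈ e i, d ∈ D ∧ ∀ x ∈ e i, x ∈ D → x = d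
  misses : ∃ a ∈ e i, a ∉ D
  unsplit : ∀ j ∈ S, j ≠ i → (∀ x ∈ e j, x ∈ D) ∨ (∀ x ∈ e j, x ∉ D)

lemma IsCut.mono {ι K : Type*} {S S' : Finset ι} {e : ι → Finset K} {i : ι} {D : Set K}
    (h : IsCut S e i D) (hS : S' ⊆ S) : IsCut S' e i D :=
  ⟨h.meets, h.misses, fun j hj => h.unsplit j (hS hj)⟩

open Classical in
/-- If every edge has a cut, then there is a cut that avoids a given vertex `v`,
or one that contains all the other edges. -/
lemma exists_extremal_cut {ι K : Type*} (S : Finset ι) (e : ι → Finset K)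
    (hcut : ∀ i ∈ S, ∃ D, IsCut S e i D) (v : K) (hS : S.Nonempty) :
    ∃ i ∈ S, ∃ D, IsCut S e i D ∧ (v ∉ D ∨ ∀ j ∈ S, j ≠ i → ∀ x ∈ e j, x ∈ D) := by
  obtain ⟨E, hE⟩ : ∃ E : Set K → Finset ι, ∀ D i, i ∈ E D ↔ i ∈ S ∧ ∀ x ∈ e i, x ∈ D :=
    ⟨fun D => S.filter fun j => ∀ x ∈ e j, x ∈ D, fun D i => Finset.mem_filter⟩
  -- Induction on the number of edges not contained in `D`: as long as neither alternative holds,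
  -- some cut contains more edges.
  suffices H : ∀ n, ∀ i ∈ S, ∀ D, IsCut S e i D → S.card - (E D).card = n →
      ∃ i ∈ S, ∃ D, IsCut S e i D ∧ (v ∉ D ∨ ∀ j ∈ S, j ≠ i → ∀ x ∈ e j, x ∈ D) by
    obtain ⟨i, hi⟩ := hS
    obtain ⟨D, hD⟩ := hcut i hi
    exact H _ i hi D hD rfl
  intro n
  induction n using Nat.strong_induction_on with
  | _ n ih =>
  intro i hi D hD hn
  by_cases hv : v ∈ D
  swap
  · exact ⟨i, hi, D, hD, Or.inl hv⟩
  by_cases hall : ∀ j ∈ S, j ≠ i → ∀ x ∈ e j, x ∈ D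
  · exact ⟨i, hi, D, hD, Or.inr hall⟩
  push Not at hall
  obtain ⟨j, hj, hji, y, hy, hyD⟩ := hall
  have hjD : ∀ x ∈ e j, x ∉ D := (hD.unsplit j hj hji).resolve_left fun h => hyD (h y hy)
  obtain ⟨D', hD'⟩ := hcut j hj
  obtain ⟨d', hd', hd'D, hd'u⟩ := hD'.meets
  obtain ⟨a', ha', ha'D⟩ := hD'.misses
  rcases hD'.unsplit i hi hji.symm with hin | hout
  -- `D` is disjoint from `e j`, so the union meets `e j` exactly where `D'` does. It keeps every
  -- edge inside `D` and gains `e i`, which `D` alone splits.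
  · have hU : IsCut S e j (D ∪ D') := by
      refine ⟨⟨d', hd', Or.inr hd'D, fun x hx hxD => hd'u x hx (hxD.resolve_left (hjD x hx))⟩,
        ⟨a', ha', fun h => h.elim (hjD a' ha') ha'D⟩, fun k hk hkj => ?_⟩
      by_cases hki : k = i
      · subst hki
        exact Or.inl fun x hx => Or.inr (hin x hx)
      rcases hD.unsplit k hk hki with h | h
      · exact Or.inl fun x hx => Or.inl (h x hx)
      rcases hD'.unsplit k hk hkj with h' | h'
      · exact Or.inl fun x hx => Or.inr (h' x hx)
      · exact Or.inr fun x hx hx' => hx'.elim (h x hx) (h' x hx)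
    refine ih _ ?_ j hj _ hU rfl
    have hlt : (E D).card < (E (D ∪ D')).card := by
      apply Finset.card_lt_card
      rw [Finset.ssubset_iff_of_subset]
      · obtain ⟨a, ha, haD⟩ := hD.misses
        refine ⟨i, (hE _ _).2 ⟨hi, fun x hx => Or.inr (hin x hx)⟩, fun h => ?_⟩
        exact haD (((hE _ _).1 h).2 a ha)
      · intro k hk
        rw [hE] at hk ⊢
        exact ⟨hk.1, fun x hx => Or.inl (hk.2 x hx)⟩
    have hle : (E (D ∪ D')).card ≤ S.card := Finset.card_le_card fun k hk => ((hE _ _).1 hk).1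
    omega
  -- Here `D'` misses `e i`, the only edge that `D` splits, so the difference splits only `e j`; it
  -- avoids `v` because `v ∈ D`.
  · refine ⟨j, hj, D' \ D, ⟨⟨d', hd', ⟨hd'D, hjD d' hd'⟩, fun x hx hxD => hd'u x hx hxD.1⟩,
        ⟨a', ha', fun h => ha'D h.1⟩, fun k hk hkj => ?_⟩, Or.inl fun h => h.2 hv⟩
    by_cases hki : k = i
    · subst hki
      exact Or.inr fun x hx hx' => hout x hx hx'.1
    rcases hD.unsplit k hk hki with h | h
    · exact Or.inr fun x hx hx' => hx'.2 (h x hx)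
    rcases hD'.unsplit k hk hkj with h' | h'
    · exact Or.inl fun x hx => ⟨h' x hx, h x hx⟩
    · exact Or.inr fun x hx hx' => h' x hx hx'.1

lemma zmod_two_eq_add_one {a b : ZMod 2} (h : a ≠ b) : b = a + 1 := by
  revert a b; decide

open Classical in
lemma sum_flip {K : Type*} {E : Finset K} {a : K} (ha : a ∈ E) {τ σ : K → ZMod 2}
    (h1 : σ a = τ a + 1) (h2 : ∀ x ∈ E, x ≠ a → σ x = τ x) :
    ∑ x ∈ E, σ x = ∑ x ∈ E, τ x + 1 := by
  rw [← Finset.add_sum_erase E σ ha, ← Finset.add_sum_erase E τ ha, h1,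
    Finset.sum_congr rfl fun x hx => h2 x (Finset.mem_of_mem_erase hx) (Finset.ne_of_mem_erase hx)]
  ring

open Classical in
/-- A system of parity constraints all of whose hyperedges have cuts is solvable,
even with the value of one variable prescribed. -/
theorem exists_parity_solution {ι K : Type*} (S : Finset ι) (e : ι → Finset K)
    (hcut : ∀ i ∈ S, ∃ D, IsCut S e i D) (r : ι → ZMod 2) (v : K) (b : ZMod 2) :
    ∃ τ : K → ZMod 2, (∀ i ∈ S, ∑ x ∈ e i, τ x = r i) ∧ τ v = b := by
  induction hn : S.card generalizing S v b with
  | zero =>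
    rw [Finset.card_eq_zero] at hn
    subst hn
    exact ⟨fun _ => b, by simp, rfl⟩
  | succ n ih =>
    obtain ⟨i, hi, D, hD, hvD⟩ :=
      exists_extremal_cut S e hcut v (Finset.card_pos.1 (by omega))
    have ih' := fun v b => ih (S.erase i)
      (fun j hj => (hcut j (Finset.mem_of_mem_erase hj)).imp fun D hD =>
        hD.mono (Finset.erase_subset _ _)) v b
      (by rw [Finset.card_erase_of_mem hi]; omega)
    obtain ⟨τ, hτ, hτv⟩ := ih' v b
    by_cases hsat : ∑ x ∈ e i, τ x = r i
    · refine ⟨τ, fun j hj => ?_, hτv⟩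
      by_cases hji : j = i
      · rw [hji, hsat]
      · exact hτ j (Finset.mem_erase.2 ⟨hji, hj⟩)
    have hr := zmod_two_eq_add_one hsat
    by_cases hv : v ∈ D
    · have hall := hvD.resolve_left (not_not.2 hv)
      -- All other edges lie inside `D`, so flipping `a ∉ D` repairs equation `i` and affects
      -- neither the others nor `v`.
      obtain ⟨a, ha, haD⟩ := hD.misses
      refine ⟨Function.update τ a (τ a + 1), fun j hj => ?_, ?_⟩
      · by_cases hji : j = i
        · rw [hji, hr]
          exact sum_flip ha (by simp) fun x _ hx => by simp [hx]
        · rw [← hτ j (Finset.mem_erase.2 ⟨hji, hj⟩)]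
          refine Finset.sum_congr rfl fun x hx => ?_
          rw [Function.update_of_ne]
          rintro rfl
          exact haD (hall j hj hji x hx)
      · rw [Function.update_of_ne, hτv]
        rintro rfl
        exact haD hv
    · obtain ⟨d, hd, hdD, hdu⟩ := hD.meets
      -- Glue two solutions along the cut, `τ'` inside and `τ` outside. On `e i` the result differs
      -- from `τ` only at `d`, every other edge sees a single solution, and `v` lies outside.
      obtain ⟨τ', hτ', hτ'd⟩ := ih' d (τ d + 1)
      refine ⟨fun x => if x ∈ D then τ' x else τ x, fun j hj => ?_, by simp [hv, hτv]⟩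
      by_cases hji : j = i
      · rw [hji, hr]
        refine sum_flip hd (by simp [hdD, hτ'd]) fun x hx hxd => ?_
        rw [if_neg fun h => hxd (hdu x hx h)]
      · have hj' := Finset.mem_erase.2 ⟨hji, hj⟩
        rcases hD.unsplit j hj hji with h | h
        · rw [← hτ' j hj']
          exact Finset.sum_congr rfl fun x hx => if_pos (h x hx)
        · rw [← hτ j hj']
          exact Finset.sum_congr rfl fun x hx => if_neg (h x hx)

end XorReasoning

/-! ### From cycle partitions to cuts -/

namespace XorReasoning

variable {V : Type*} [DecidableEq V]

/-- Adjacency of variables that occur together in a clause of `φ` other than `c`. -/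
def avoidGraph (φ : XorConj V) (c : XorClause V) : SimpleGraph V where
  Adj x y := x ≠ y ∧ ∃ C ∈ φ, C ≠ c ∧ x ∈ C.vars ∧ y ∈ C.vars
  symm := ⟨fun _ _ ⟨h, C, hC, hc, hx, hy⟩ => ⟨h.symm, C, hC, hc, hy, hx⟩⟩
  loopless := ⟨fun _ h => h.1 rfl⟩

lemma exists_third {E : Finset V} (hE : E.card = 3) {x y : V} (hx : x ∈ E) (hy : y ∈ E)
    (hxy : x ≠ y) : ∃ z, z ≠ x ∧ z ≠ y ∧ E = {x, y, z} := by
  have hsub : ({x, y} : Finset V) ⊆ E := by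
    intro u hu
    simp only [Finset.mem_insert, Finset.mem_singleton] at hu
    rcases hu with rfl | rfl <;> assumption
  have hcard : (E \ {x, y}).card = 1 := by
    rw [Finset.card_sdiff_of_subset hsub, hE, Finset.card_pair hxy]
  obtain ⟨z, hz⟩ := Finset.card_eq_one.1 hcard
  have hz' : z ∈ E \ {x, y} := by rw [hz]; exact Finset.mem_singleton_self z
  simp only [Finset.mem_sdiff, Finset.mem_insert, Finset.mem_singleton, not_or] at hz'
  refine ⟨z, hz'.2.1, hz'.2.2, ?_⟩
  rw [← Finset.sdiff_union_of_subset hsub, hz]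
  ext u
  simp only [Finset.mem_union, Finset.mem_insert, Finset.mem_singleton]
  tauto

/-- Two variables of a clause `c` that are connected without `c` are consecutive inner variables
of an xor-cycle through `c`. -/
lemma exists_cycle_of_reachable {φ : XorConj V} (h3 : ∀ C ∈ φ, C.vars.card = 3)
    {a b d : V} {q : ZMod 2} (hc : ⟨{a, b, d}, q⟩ ∈ φ) (hab : a ≠ b) (hda : d ≠ a) (hdb : d ≠ b)
    (hr : (avoidGraph φ ⟨{a, b, d}, q⟩).Reachable a b) :
    ∃ (n : ℕ) (x y : Fin n → V) (p : Fin n → ZMod 2), IsXorCycleIn φ x y p ∧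
      (∃ i, x i = a) ∧ (∃ i, x i = b) ∧ (∃ i, y i = d) := by
  set c : XorClause V := ⟨{a, b, d}, q⟩ with hcdef
  set G := avoidGraph φ c
  obtain ⟨w, hw⟩ := hr.exists_walk_length_eq_dist
  have hpath : w.IsPath := w.isPath_of_length_eq_dist hw
  obtain ⟨m, hm⟩ : ∃ m, w.length = m + 1 := by
    refine Nat.exists_eq_succ_of_ne_zero fun h => hab ?_
    exact SimpleGraph.Walk.eq_of_length_eq_zero h
  have hstep : ∀ i : Fin (m + 1), ∃ C ∈ φ, C ≠ c ∧ w.getVert i ∈ C.vars ∧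
      w.getVert (i + 1) ∈ C.vars := fun i =>
    (w.adj_getVert_succ (by omega : (i : ℕ) < w.length)).2
  have hne : ∀ i : Fin (m + 1), w.getVert i ≠ w.getVert (i + 1) := fun i =>
    (w.adj_getVert_succ (by omega : (i : ℕ) < w.length)).1
  choose C hCφ hCc hC1 hC2 using hstep
  choose z hz1 hz2 hzC using fun i => exists_third (h3 _ (hCφ i)) (hC1 i) (hC2 i) (hne i)
  -- A clause serving steps `i < j` would join vertex `i` directly to vertex `j + 1`, which shortens
  -- a shortest walk.
  have hCinj : ∀ i j : Fin (m + 1), i < j → C i ≠ C j := by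
    intro i j hij hCij
    have hij' : (i : ℕ) < j := hij
    have h1 : w.getVert i ∈ (C j).vars := hCij ▸ hC1 i
    have hd1 : G.Adj (w.getVert i) (w.getVert (j + 1)) := by
      refine ⟨fun h => ?_, C j, hCφ j, hCc j, h1, hC2 j⟩
      have := hpath.getVert_injOn (by simp; omega) (by simp; omega) h
      omega
    let w' := ((w.take i).append (SimpleGraph.Walk.cons hd1 (w.drop (j + 1))))
    have hlen := SimpleGraph.dist_le w'
    simp only [w', SimpleGraph.Walk.length_append, SimpleGraph.Walk.length_cons,
      SimpleGraph.Walk.take_length, SimpleGraph.Walk.drop_length] at hlen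
    omega
  have hrotL : finRotate (m + 2) (Fin.last (m + 1)) = 0 := finRotate_last
  have hrotC : ∀ i : Fin (m + 1), finRotate (m + 2) i.castSucc = i.succ := fun i => by
    rw [finRotate_of_lt (by simpa using i.2)]
    rfl
  -- The `m + 1` steps of the path give the first clauses of the cycle; `c` itself, with outer
  -- variable `d`, closes it at the last index.
  let x : Fin (m + 2) → V := fun i => w.getVert i
  let y : Fin (m + 2) → V := Fin.snoc (α := fun _ => V) z d
  let p : Fin (m + 2) → ZMod 2 := Fin.snoc (α := fun _ => ZMod 2) (fun i => (C i).rhs) q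
  have hx0 : x 0 = a := by simp [x]
  have hxl : x (Fin.last (m + 1)) = b := by
    simp only [x, Fin.val_last]
    rw [← hm, SimpleGraph.Walk.getVert_length]
  have hyl : y (Fin.last (m + 1)) = d := by simp [y]
  have hclC : ∀ i : Fin (m + 1), cycleClause x y p i.castSucc = C i := by
    intro i
    unfold cycleClause
    rw [hrotC]
    ext1
    · rw [hzC i]; simp [x, y]
    · simp [p]
  have hclL : cycleClause x y p (Fin.last (m + 1)) = c := by
    unfold cycleClause
    rw [hrotL, hx0, hxl, hyl, hcdef]
    ext1
    · exact Finset.insert_comm _ _ _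
    · simp [p]
  refine ⟨m + 2, x, y, p, ⟨by omega, ?_, ?_, ?_, ?_⟩, ⟨_, hx0⟩, ⟨_, hxl⟩, ⟨_, hyl⟩⟩
  · intro i j hij
    exact Fin.ext (hpath.getVert_injOn (by simp; omega) (by simp; omega) hij)
  · intro i
    induction i using Fin.lastCases with
    | last => rw [hrotL, hx0, hxl, hyl]; exact ⟨hdb, hda⟩
    | cast i => rw [hrotC]; simpa [x, y] using ⟨hz1 i, hz2 i⟩
  · intro i j hij
    induction i using Fin.lastCases with
    | last =>
      induction j using Fin.lastCases with
      | last => rfl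
      | cast j => rw [hclL, hclC] at hij; exact absurd hij.symm (hCc j)
    | cast i =>
      induction j using Fin.lastCases with
      | last => rw [hclL, hclC] at hij; exact absurd hij (hCc i)
      | cast j =>
        rw [hclC, hclC] at hij
        rcases lt_trichotomy i j with h | h | h
        · exact absurd hij (hCinj i j h)
        · rw [h]
        · exact absurd hij.symm (hCinj j i h)
  · intro i
    induction i using Fin.lastCases with
    | last => rw [hclL]; exact hc
    | cast i => rw [hclC]; exact hCφ i

lemma avoidGraph_reachable {φ : XorConj V} {c C : XorClause V} (hC : C ∈ φ) (hCc : C ≠ c)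
    {x y : V} (hx : x ∈ C.vars) (hy : y ∈ C.vars) : (avoidGraph φ c).Reachable x y := by
  by_cases h : x = y
  · rw [h]
  · exact SimpleGraph.Adj.reachable ⟨h, C, hC, hCc, hx, hy⟩

/-- Each clause of a cycle-partitionable conjunction has a variable that is disconnected from the
other variables of the clause when the clause is removed. -/
lemma IsCyclePartitionable.exists_cut {φ : XorConj V} (h3 : ∀ C ∈ φ, C.vars.card = 3)
    (hp : IsCyclePartitionable φ) {c : XorClause V} (hc : c ∈ φ) :
    ∃ D : Set V, IsCut φ XorClause.vars c D := by
  obtain ⟨Vin, Vout, hdisj, -, hcyc⟩ := hp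
  have hall : ∀ a b d : V, a ≠ b → d ≠ a → d ≠ b → c.vars = {a, b, d} →
      (avoidGraph φ c).Reachable a b → a ∈ Vin ∧ b ∈ Vin ∧ d ∈ Vout := by
    intro a b d hab hda hdb hv hr
    have hcc : c = ⟨{a, b, d}, c.rhs⟩ := by ext1 <;> simp [hv]
    rw [hcc] at hr hc
    obtain ⟨n, x, y, p, hxy, ⟨i, hi⟩, ⟨j, hj⟩, ⟨k, hk⟩⟩ :=
      exists_cycle_of_reachable h3 hc hab hda hdb hr
    obtain ⟨hin, hout⟩ := hcyc n x y p hxy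
    exact ⟨hi ▸ hin i, hj ▸ hin j, hk ▸ hout k⟩
  have hsep : ∃ d ∈ c.vars, ∀ x ∈ c.vars, (avoidGraph φ c).Reachable d x → x = d := by
    by_contra hcon
    push Not at hcon
    obtain ⟨a, b, d, hab, had, hbd, hv⟩ := Finset.card_eq_three.1 (h3 c hc)
    -- The cycle through `a` and `b` makes `d` outer, while the cycle through `a` and `d` makes it
    -- inner.
    have hno : ∀ a b d : V, a ≠ b → d ≠ a → d ≠ b → c.vars = {a, b, d} →
        ¬ ((avoidGraph φ c).Reachable a b ∧ (avoidGraph φ c).Reachable a d) := by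
      rintro a b d hab hda hdb hv ⟨h1, h2⟩
      have h := hall a b d hab hda hdb hv h1
      have h' := hall a d b hda.symm hab.symm hdb.symm (by rw [hv, Finset.pair_comm]) h2
      exact Finset.disjoint_left.1 hdisj h'.2.1 h.2.2
    have hn1 := hno a b d hab had.symm hbd.symm hv
    have ha := hcon a (by simp [hv])
    have hb := hcon b (by simp [hv])
    have hd := hcon d (by simp [hv])
    simp only [hv, Finset.mem_insert, Finset.mem_singleton] at ha hb hd
    have tr := fun x y z => @SimpleGraph.Reachable.trans _ (avoidGraph φ c) x y z
    have sy := fun x y => @SimpleGraph.Reachable.symm _ (avoidGraph φ c) x y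
    -- If each of three vertices is connected to another one, then all three are connected, contrary
    -- to `hn1`.
    obtain ⟨u, rfl | rfl | rfl, hu, hu'⟩ := ha
    · exact hu' rfl
    · obtain ⟨t, rfl | rfl | rfl, ht, ht'⟩ := hd
      · exact hn1 ⟨hu, sy _ _ ht⟩
      · exact hn1 ⟨hu, tr _ _ _ hu (sy _ _ ht)⟩
      · exact ht' rfl
    · obtain ⟨t, rfl | rfl | rfl, ht, ht'⟩ := hb
      · exact hn1 ⟨sy _ _ ht, hu⟩
      · exact ht' rfl
      · exact hn1 ⟨tr _ _ _ hu (sy _ _ ht), hu⟩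
  obtain ⟨d, hd, hdu⟩ := hsep
  refine ⟨{x | (avoidGraph φ c).Reachable d x}, ⟨d, hd, SimpleGraph.Reachable.refl d, hdu⟩, ?_, ?_⟩
  · obtain ⟨a, ha, had⟩ := Finset.exists_mem_ne (by rw [h3 c hc]; norm_num) d
    exact ⟨a, ha, fun h => had (hdu a ha h)⟩
  · intro C hC hCc
    by_cases h : ∃ x ∈ C.vars, (avoidGraph φ c).Reachable d x
    · obtain ⟨x, hx, hr⟩ := h
      exact Or.inl fun y hy => hr.trans (avoidGraph_reachable hC hCc hx hy)
    · push Not at h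
      exact Or.inr h

end XorReasoning

/-! ### Saturated clause sets and their models -/

namespace XorReasoning

/-- `ParityChain R x y p`: there is an `R`-chain from `x` to `y` whose parities add up to `p`. -/
inductive ParityChain {V : Type*} (R : V → V → ZMod 2 → Prop) : V → V → ZMod 2 → Prop
  | nil (x : V) : ParityChain R x x 0
  | cons {x y z : V} {p q : ZMod 2} :
      R x y p → ParityChain R y z q → ParityChain R x z (p + q)

namespace ParityChain

variable {V : Type*}

lemma single {R : V → V → ZMod 2 → Prop} {x y : V} {p : ZMod 2} (h : R x y p) :
    ParityChain R x y p := by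
  simpa using cons h (nil y)

lemma trans {R : V → V → ZMod 2 → Prop} {x y z : V} {p q : ZMod 2}
    (h : ParityChain R x y p) (h' : ParityChain R y z q) : ParityChain R x z (p + q) := by
  induction h with
  | nil => simpa using h'
  | cons h1 _ ih => rw [add_assoc]; exact cons h1 (ih h')

lemma symm {R : V → V → ZMod 2 → Prop} (hR : ∀ x y p, R x y p → R y x p) {x y : V} {p : ZMod 2}
    (h : ParityChain R x y p) : ParityChain R y x p := by
  induction h with
  | nil => exact nil _
  | cons h1 _ ih => rw [add_comm]; exact ih.trans (single (hR _ _ _ h1))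

lemma mono {R R' : V → V → ZMod 2 → Prop} (hR : ∀ x y p, R x y p → R' x y p) {x y : V}
    {p : ZMod 2} (h : ParityChain R x y p) : ParityChain R' x y p := by
  induction h with
  | nil => exact nil _
  | cons h1 _ ih => exact cons (hR _ _ _ h1) ih

end ParityChain

variable {V : Type*} [DecidableEq V]

/-- A set of clauses that is closed under unit propagation and equivalence reasoning,
and that contains no evident contradiction. -/
structure Saturated (T : XorClause V → Prop) : Prop where
  lit_unique : ∀ x p q, T (XorClause.lit x p) → T (XorClause.lit x q) → p = q
  unit2 : ∀ x y p q, x ≠ y → T (XorClause.lit x p) → T ⟨{x, y}, q⟩ → T (XorClause.lit y (p + q))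
  unit3 : ∀ x y z p q, x ≠ y → x ≠ z → y ≠ z → T (XorClause.lit x p) → T ⟨{x, y, z}, q⟩ →
    T ⟨{y, z}, p + q⟩
  chain_closed : ∀ x p, ParityChain (fun x y p => x ≠ y ∧ T ⟨{x, y}, p⟩) x x p → p = 0
  chain_imply : ∀ x y z p q, x ≠ y → z ≠ x → z ≠ y →
    ParityChain (fun x y p => x ≠ y ∧ T ⟨{x, y}, p⟩) x y p → T ⟨{x, y, z}, q⟩ →
    T (XorClause.lit z (p + q))

/-- A clause of `φ` together with a literal of `T` on one of its variables yields
`x ⊕ y ≡ p`. -/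
def UnitStep (φ : XorConj V) (T : XorClause V → Prop) (x y : V) (p : ZMod 2) : Prop :=
  x ≠ y ∧ ∃ z r q, z ≠ x ∧ z ≠ y ∧ T (XorClause.lit z r) ∧ ⟨{z, x, y}, q⟩ ∈ φ ∧ p = r + q

lemma UnitStep.symm {φ : XorConj V} {T : XorClause V → Prop} {x y : V} {p : ZMod 2}
    (h : UnitStep φ T x y p) : UnitStep φ T y x p := by
  obtain ⟨hxy, z, r, q, h1, h2, h3, h4, h5⟩ := h
  exact ⟨hxy.symm, z, r, q, h2, h1, h3, by rwa [Finset.pair_comm], h5⟩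

lemma UnitStep.mem {φ : XorConj V} {T : XorClause V → Prop} (hT : Saturated T)
    (hφ : ∀ C ∈ φ, T C) {x y : V} {p : ZMod 2}
    (h : UnitStep φ T x y p) : x ≠ y ∧ T ⟨{x, y}, p⟩ := by
  obtain ⟨hxy, z, r, q, h1, h2, h3, h4, rfl⟩ := h
  exact ⟨hxy, hT.unit3 z x y r q h1 h2 hxy h3 (hφ _ h4)⟩

/-- Variables connected by a chain of `UnitStep`s. -/
def chainSetoid (φ : XorConj V) (T : XorClause V → Prop) : Setoid V where
  r x y := ∃ p, ParityChain (UnitStep φ T) x y p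
  iseqv := ⟨fun x => ⟨0, .nil x⟩, fun ⟨p, h⟩ => ⟨p, h.symm fun _ _ _ h => h.symm⟩,
    fun ⟨_, h⟩ ⟨_, h'⟩ => ⟨_, h.trans h'⟩⟩

lemma chainSetoid_mk_eq {φ : XorConj V} {T : XorClause V → Prop} {x y : V} :
    Quotient.mk (chainSetoid φ T) x = Quotient.mk (chainSetoid φ T) y ↔
      ∃ p, ParityChain (UnitStep φ T) x y p :=
  Quotient.eq

lemma zmod_two_add_add_cancel (s a b : ZMod 2) : (s + a) + (s + b) = a + b := by
  revert s a b; decide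

/-- A family of parities that is additive along chains. -/
lemma exists_potential {φ : XorConj V} {T : XorClause V → Prop} (hT : Saturated T)
    (hφ : ∀ C ∈ φ, T C) :
    ∃ w : V → ZMod 2, ∀ x y p, UnitStep φ T x y p → w x + w y = p := by
  have h : ∀ x : V, ∃ p, ParityChain (UnitStep φ T)
      (Quotient.out (Quotient.mk (chainSetoid φ T) x)) x p :=
    fun x => chainSetoid_mk_eq.1 (Quotient.out_eq _)
  choose w hw using h
  refine ⟨w, fun x y p hxy => ?_⟩
  have hx := hw x
  rw [chainSetoid_mk_eq.2 ⟨p, .single hxy⟩] at hx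
  -- `w` measures parity from a class representative; going to `x`, on to `y` and back is a closed
  -- chain of parity `w x + p + w y`.
  have h0 := hT.chain_closed _ _ (((hx.trans (.single hxy)).trans
    ((hw y).symm fun _ _ _ h => h.symm)).mono fun _ _ _ h => h.mem hT hφ)
  generalize w x = a at *
  generalize w y = b at *
  clear hx hw hxy
  revert a b p; decide

lemma sum_triple {f : V → ZMod 2} {x y z : V} (hxy : x ≠ y) (hxz : x ≠ z) (hyz : y ≠ z) :
    ∑ u ∈ ({x, y, z} : Finset V), f u = f x + f y + f z := by
  rw [Finset.sum_insert (by simp [hxy, hxz]), Finset.sum_pair hyz, add_assoc]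

open Classical in
/-- Saturation implies satisfiability, with the value of any one undetermined variable free. -/
theorem Saturated.exists_model {φ : XorConj V} {T : XorClause V → Prop} (hT : Saturated T)
    (hφ : ∀ C ∈ φ, T C) (h3 : ∀ C ∈ φ, C.vars.card = 3)
    (hcut : ∀ c ∈ φ, ∃ D, IsCut φ XorClause.vars c D) (v : V) (b : ZMod 2) :
    ∃ τ : V → ZMod 2, (∀ C ∈ φ, C.Sat τ) ∧ (∀ x p, T (XorClause.lit x p) → τ x = p) ∧
      ((∀ p, ¬ T (XorClause.lit v p)) → τ v = b) := by
  obtain ⟨w, hw⟩ := exists_potential hT hφ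
  set s := chainSetoid φ T with hs
  let S : XorConj V := φ.filter fun C => ∀ x ∈ C.vars, ∀ p, ¬ T (XorClause.lit x p)
  -- A `UnitStep` comes from a clause of `φ` with a determined variable, hence not from `c`, so `D`
  -- does not split it. Thus `D` is a union of classes and descends to the quotient.
  have hsatD : ∀ c ∈ S, ∀ D, IsCut φ XorClause.vars c D → ∀ x y p,
      ParityChain (UnitStep φ T) x y p → (x ∈ D ↔ y ∈ D) := by
    intro c hc D hD x y p h
    induction h with
    | nil => rfl
    | @cons x y _ _ _ h1 _ ih =>
      rw [← ih]
      obtain ⟨-, z, r, q, -, -, hz, hC, -⟩ := h1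
      have hne : (⟨{z, x, y}, q⟩ : XorClause V) ≠ c := by
        rintro rfl
        exact (Finset.mem_filter.1 hc).2 z (by simp) r hz
      rcases hD.unsplit _ hC hne with h | h <;> simp only [Finset.mem_insert,
        Finset.mem_singleton, forall_eq_or_imp, forall_eq] at h <;> tauto
  -- If two variables of `c` were merged, `chain_imply` would determine the third. So the quotient
  -- map does not collapse edges of `S`, and sums over them carry over.
  have hinj : ∀ c ∈ S, ∀ x ∈ c.vars, ∀ y ∈ c.vars,
      (Quotient.mk s x) = Quotient.mk s y → x = y := by
    intro c hc x hx y hy hq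
    by_contra hxy
    obtain ⟨p, hp⟩ := chainSetoid_mk_eq.1 hq
    obtain ⟨hcφ, hcT⟩ := Finset.mem_filter.1 hc
    obtain ⟨z, hzx, hzy, hz⟩ := exists_third (h3 c hcφ) hx hy hxy
    have hcc : c = ⟨{x, y, z}, c.rhs⟩ := by ext1 <;> simp [hz]
    exact hcT z (by simp [hz]) _ (hT.chain_imply x y z p c.rhs hxy hzx hzy
      (hp.mono fun _ _ _ h => h.mem hT hφ) (hcc ▸ hφ c hcφ))
  have hcutQ : ∀ c ∈ S, ∃ D, IsCut S (fun C => C.vars.image (Quotient.mk s)) c D := by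
    intro c hc
    obtain ⟨D, hD⟩ := hcut c (Finset.mem_filter.1 hc).1
    have hmem : ∀ x, Quotient.mk s x ∈ Quotient.mk s '' D ↔ x ∈ D := by
      refine fun x => ⟨?_, fun h => ⟨x, h, rfl⟩⟩
      rintro ⟨y, hy, hyx⟩
      obtain ⟨p, hp⟩ := chainSetoid_mk_eq.1 hyx
      exact (hsatD c hc D hD y x p hp).1 hy
    refine ⟨Quotient.mk s '' D, ?_, ?_, ?_⟩
    · obtain ⟨d, hd, hdD, hdu⟩ := hD.meets
      refine ⟨Quotient.mk s d, Finset.mem_image_of_mem _ hd, (hmem d).2 hdD, fun k hk hkD => ?_⟩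
      obtain ⟨x, hx, rfl⟩ := Finset.mem_image.1 hk
      rw [hdu x hx ((hmem x).1 hkD)]
    · obtain ⟨a, ha, haD⟩ := hD.misses
      exact ⟨Quotient.mk s a, Finset.mem_image_of_mem _ ha, fun h => haD ((hmem a).1 h)⟩
    · intro C hC hCc
      refine (hD.unsplit C (Finset.mem_filter.1 hC).1 hCc).imp ?_ ?_ <;>
      · intro h k hk
        obtain ⟨x, hx, rfl⟩ := Finset.mem_image.1 hk
        rw [hmem]
        exact h x hx
  -- The substitution `τ x = σ [x] + w x` shifts each right-hand side, and the prescribed value `b`,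
  -- by the corresponding `w`.
  obtain ⟨σ, hσ, hσv⟩ := exists_parity_solution S (fun C => C.vars.image (Quotient.mk s)) hcutQ
    (fun C => C.rhs + ∑ x ∈ C.vars, w x) (Quotient.mk s v) (b + w v)
  let τ : V → ZMod 2 := fun x =>
    if h : ∃ p, T (XorClause.lit x p) then h.choose else σ (Quotient.mk s x) + w x
  have hτ1 : ∀ x p, T (XorClause.lit x p) → τ x = p := by
    intro x p h
    have hex : ∃ p, T (XorClause.lit x p) := ⟨p, h⟩
    simp only [τ, dif_pos hex]
    exact hT.lit_unique x _ _ hex.choose_spec h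
  have hτ2 : ∀ x, (∀ p, ¬ T (XorClause.lit x p)) → τ x = σ (Quotient.mk s x) + w x := by
    intro x h
    exact dif_neg (not_exists.2 h)
  refine ⟨τ, fun C hC => ?_, hτ1, fun h => ?_⟩
  swap
  · rw [hτ2 v h, hσv, add_assoc, CharTwo.add_self_eq_zero, add_zero]
  by_cases hCS : C ∈ S
  · have h1 := hσ C hCS
    rw [Finset.sum_image (hinj C hCS)] at h1
    unfold XorClause.Sat
    rw [Finset.sum_congr rfl fun x hx => hτ2 x ((Finset.mem_filter.1 hCS).2 x hx),
      Finset.sum_add_distrib, h1, add_assoc, CharTwo.add_self_eq_zero, add_zero]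
  · have hz : ∃ z ∈ C.vars, ∃ r, T (XorClause.lit z r) := by
      by_contra hcon
      push Not at hcon
      exact hCS (Finset.mem_filter.2 ⟨hC, hcon⟩)
    obtain ⟨z, hz, r, hzr⟩ := hz
    obtain ⟨x, hx, hxz⟩ := Finset.exists_mem_ne (by rw [h3 C hC]; norm_num) z
    obtain ⟨y, hyz, hyx, hv⟩ := exists_third (h3 C hC) hz hx hxz.symm
    have hCC : C = ⟨{z, x, y}, C.rhs⟩ := by ext1 <;> simp [hv]
    have hstep : UnitStep φ T x y (r + C.rhs) :=
      ⟨hyx.symm, z, r, C.rhs, hxz.symm, hyz.symm, hzr, hCC ▸ hC, rfl⟩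
    -- By `unit2`, `x` and `y` are both determined or both undetermined; in the latter case they
    -- share a class and `w` accounts for the parity.
    have hxy : τ x + τ y = r + C.rhs := by
      by_cases hx' : ∃ p, T (XorClause.lit x p)
      · obtain ⟨p, hp⟩ := hx'
        rw [hτ1 x p hp, hτ1 y _ (hT.unit2 x y p _ hyx.symm hp (hstep.mem hT hφ).2), ← add_assoc,
          CharTwo.add_self_eq_zero, zero_add]
      · have hy' : ¬ ∃ p, T (XorClause.lit y p) := fun ⟨p, hp⟩ =>
          hx' ⟨_, hT.unit2 y x p _ hyx hp (hstep.symm.mem hT hφ).2⟩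
        have hq : Quotient.mk s x = Quotient.mk s y := chainSetoid_mk_eq.2 ⟨_, .single hstep⟩
        rw [hτ2 x (not_exists.1 hx'), hτ2 y (not_exists.1 hy'), hq, zmod_two_add_add_cancel,
          hw x y _ hstep]
    unfold XorClause.Sat
    rw [hv, sum_triple hxz.symm hyz.symm hyx.symm, add_assoc, hxy, hτ1 z r hzr, ← add_assoc,
      CharTwo.add_self_eq_zero, zero_add]

end XorReasoning

/-! ### Deducibility from saturation, and saturation for both systems -/

namespace XorReasoning

section

variable {V : Type*}

/-! ### Soundness -/

/-- Every rule of `R` is sound. -/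
def Sound (R : DeductionSystem V) : Prop :=
  ∀ P D, R P D → ∀ τ : V → ZMod 2, (∀ E ∈ P, E.Sat τ) → D.Sat τ

lemma Derivable.sat {R : DeductionSystem V} (hR : Sound R) {ψ : XorConj V} {D : XorClause V}
    (h : Derivable R ψ D) {τ : V → ZMod 2} (hτ : ∀ C ∈ ψ, C.Sat τ) : D.Sat τ := by
  induction h with
  | mem h => exact hτ _ h
  | step h _ ih => exact hR _ _ h τ ih

@[simp]
lemma sat_lit {τ : V → ZMod 2} {x : V} {p : ZMod 2} : (XorClause.lit x p).Sat τ ↔ τ x = p := by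
  simp [XorClause.Sat, XorClause.lit]

end

variable {V : Type*} [DecidableEq V]

lemma sat_pair {τ : V → ZMod 2} {x y : V} {p : ZMod 2} (h : x ≠ y) :
    (⟨{x, y}, p⟩ : XorClause V).Sat τ ↔ τ x + τ y = p := by
  rw [XorClause.Sat, Finset.sum_pair h]

lemma sat_triple {τ : V → ZMod 2} {x y z : V} {p : ZMod 2} (hxy : x ≠ y) (hxz : x ≠ z)
    (hyz : y ≠ z) : (⟨{x, y, z}, p⟩ : XorClause V).Sat τ ↔ τ x + τ y + τ z = p := by
  rw [XorClause.Sat, sum_triple hxy hxz hyz]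

lemma sum_symmDiff_zmod_two (A B : Finset V) (τ : V → ZMod 2) :
    ∑ x ∈ symmDiff A B, τ x = ∑ x ∈ A, τ x + ∑ x ∈ B, τ x := by
  rw [symmDiff_def, Finset.sup_eq_union, Finset.sum_union disjoint_sdiff_sdiff,
    ← Finset.sum_inter_add_sum_sdiff A B, ← Finset.sum_inter_add_sum_sdiff B A,
    Finset.inter_comm B A, zmod_two_add_add_cancel]

lemma sat_subst {τ : V → ZMod 2} {C : XorClause V} {x : V} {W : Finset V} {c : ZMod 2}
    (hx : τ x = ∑ y ∈ W, τ y + c) (hC : C.Sat τ) : (C.subst x W c).Sat τ := by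
  unfold XorClause.subst
  split_ifs with h
  · unfold XorClause.Sat at hC ⊢
    rw [sum_symmDiff_zmod_two, ← hC, ← Finset.add_sum_erase _ τ h, hx]
    generalize ∑ y ∈ W, τ y = a
    generalize ∑ y ∈ C.vars.erase x, τ y = b
    linear_combination (-c) * (CharTwo.two_eq_zero : (2 : ZMod 2) = 0)
  · exact hC

lemma substRule_sound : Sound (SubstRule (V := V)) := by
  intro P D h τ hP
  have key : ∀ a b c : ZMod 2, a + b = c → a = b + c := by decide
  cases h with
  | up h =>
    cases h <;> simp only [Set.mem_insert_iff, Set.mem_singleton_iff, forall_eq_or_imp,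
      forall_eq, sat_lit] at hP <;> exact sat_subst (by simp [hP.1]) hP.2
  | eqvPos x y C hxy | eqvNeg x y C hxy =>
    simp only [Set.mem_insert_iff, Set.mem_singleton_iff, forall_eq_or_imp,
      forall_eq, sat_pair hxy] at hP
    exact sat_subst (by rw [Finset.sum_singleton]; exact key _ _ _ hP.1) hP.2

lemma ecRule_sound : Sound (ECRule (V := V)) := by
  intro P D h τ hP
  cases h with
  | conflict x =>
    have h1 := hP _ (Set.mem_insert _ _)
    have h0 := hP (XorClause.lit x 0) (by simp)
    rw [sat_lit] at h0 h1
    rw [h0] at h1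
    exact absurd h1 (by decide)
  | unit2 x y p q hxy =>
    simp only [Set.mem_insert_iff, Set.mem_singleton_iff, forall_eq_or_imp,
      forall_eq, sat_pair hxy, sat_lit] at hP
    rw [sat_lit, ← hP.1, ← hP.2, ← add_assoc, CharTwo.add_self_eq_zero, zero_add]
  | unit3 x y z p q hxy hxz hyz =>
    simp only [Set.mem_insert_iff, Set.mem_singleton_iff, forall_eq_or_imp,
      forall_eq, sat_triple hxy hxz hyz, sat_lit] at hP
    rw [sat_pair hyz, ← hP.1, ← hP.2, ← add_assoc, ← add_assoc, CharTwo.add_self_eq_zero, zero_add]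
  | xorImply n x p y q hx h0 hy0 hyl =>
    have hq := hP _ (Set.mem_insert _ _)
    rw [sat_triple h0 hy0.symm hyl.symm] at hq
    have hp : ∀ i, p i = τ (x i.castSucc) + τ (x i.succ) := fun i =>
      ((sat_pair (hx i)).1 (hP _ (Set.mem_insert_of_mem _ ⟨i, rfl⟩))).symm
    have h1 := Fin.sum_univ_castSucc fun i => τ (x i)
    have h2 := Fin.sum_univ_succ fun i => τ (x i)
    rw [sat_lit, Finset.sum_congr rfl fun i _ => hp i, Finset.sum_add_distrib]
    rw [h1] at h2
    generalize ∑ i : Fin n, τ (x i.castSucc) = a at *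
    generalize ∑ i : Fin n, τ (x i.succ) = b at *
    generalize τ (x 0) = c at *
    generalize τ (x (Fin.last n)) = d at *
    generalize τ y = e at *
    clear h1 hP
    revert a b c d e q; decide
  | xorConflict n x p hx hp =>
    have hp' : ∀ i, p i = τ (x i) + τ (x (finRotate n i)) := fun i =>
      ((sat_pair (hx i)).1 (hP _ ⟨i, rfl⟩)).symm
    rw [Finset.sum_congr rfl fun i _ => hp' i, Finset.sum_add_distrib,
      Equiv.sum_comp (finRotate n) fun i => τ (x i), CharTwo.add_self_eq_zero] at hp
    exact absurd hp (by decide)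

/-! ### From saturation to deducibility -/

/-- If an implied literal on `x` were not derivable, soundness would exclude the opposite literal
too. Then `x` is undetermined, and a model giving it the wrong value contradicts the implication. -/
theorem deducible_of_saturated {R : DeductionSystem V} (hR : Sound R)
    (hsat : ∀ ψ, ¬ Derivable R ψ XorClause.bot → Saturated (Derivable R ψ))
    {φ : XorConj V} (h3 : ∀ C ∈ φ, C.vars.card = 3)
    (hcut : ∀ c ∈ φ, ∃ D, IsCut φ XorClause.vars c D) : Deducible R φ := by
  intro A hA
  have hmodel : ¬ Derivable R (φ ∪ A) XorClause.bot → ∀ v b, ∃ τ : V → ZMod 2,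
      (∀ C ∈ φ ∪ A, C.Sat τ) ∧ ((∀ p, ¬ Derivable R (φ ∪ A) (XorClause.lit v p)) → τ v = b) := by
    intro hbot v b
    obtain ⟨τ, h1, h2, h3⟩ := (hsat _ hbot).exists_model (φ := φ)
      (fun C hC => .mem (Finset.mem_union_left _ hC)) h3 hcut v b
    refine ⟨τ, fun C hC => ?_, h3⟩
    rcases Finset.mem_union.1 hC with h | h
    · exact h1 C h
    · obtain ⟨x, -, p, rfl⟩ := hA C h
      exact sat_lit.2 (h2 x p (.mem hC))
  refine ⟨fun hunsat => ?_, fun hsatis l hl hent => ?_⟩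
  · by_contra hbot
    refine hunsat ?_
    -- `hmodel` needs some variable to prescribe; without variables there are neither three-variable
    -- clauses nor literals.
    rcases isEmpty_or_nonempty V with hV | ⟨⟨v⟩⟩
    · refine ⟨isEmptyElim, fun C hC => ?_⟩
      rcases Finset.mem_union.1 hC with h | h
      · have := h3 C h
        simp [Finset.eq_empty_of_isEmpty C.vars] at this
      · obtain ⟨x, -⟩ := hA C h
        exact isEmptyElim x
    · obtain ⟨τ, hτ, -⟩ := hmodel hbot v 0
      exact ⟨τ, hτ⟩
  · obtain ⟨x, -, p, rfl⟩ := hl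
    obtain ⟨σ, hσ⟩ := hsatis
    have hbot : ¬ Derivable R (φ ∪ A) XorClause.bot := by
      intro h
      have := h.sat hR hσ
      simp [XorClause.Sat, XorClause.bot] at this
    obtain ⟨τ, hτ, hτx⟩ := hmodel hbot x (p + 1)
    have hp := sat_lit.1 (hent τ hτ)
    by_contra hnot
    have hnone : ∀ q, ¬ Derivable R (φ ∪ A) (XorClause.lit x q) := by
      intro q hq
      rw [sat_lit.1 (hq.sat hR hτ)] at hp
      exact hnot (hp ▸ hq)
    rw [hτx hnone] at hp
    revert hp
    simp

/-! ### The system `Subst` -/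

lemma Derivable.subst_lit {ψ : XorConj V} {x : V} {p : ZMod 2} {C : XorClause V}
    (hx : Derivable SubstRule ψ (XorClause.lit x p)) (hC : Derivable SubstRule ψ C) :
    Derivable SubstRule ψ (C.subst x ∅ p) := by
  have hp : p = 0 ∨ p = 1 := by clear * -; revert p; decide
  rcases hp with rfl | rfl
  · refine .step (.up (.unitNeg x C)) ?_
    rintro E (rfl | rfl) <;> assumption
  · refine .step (.up (.unitPos x C)) ?_
    rintro E (rfl | rfl) <;> assumption

lemma Derivable.subst_pair {ψ : XorConj V} {x y : V} {p : ZMod 2} {C : XorClause V}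
    (hxy : x ≠ y) (hx : Derivable SubstRule ψ ⟨{x, y}, p⟩) (hC : Derivable SubstRule ψ C) :
    Derivable SubstRule ψ (C.subst x {y} p) := by
  have hp : p = 0 ∨ p = 1 := by clear * -; revert p; decide
  rcases hp with rfl | rfl
  · refine .step (.eqvPos x y C hxy) ?_
    rintro E (rfl | rfl) <;> assumption
  · refine .step (.eqvNeg x y C hxy) ?_
    rintro E (rfl | rfl) <;> assumption

/-- Substitution eliminates the intermediate variables one at a time, so a chain contracts to one
binary clause. A closed chain contracts to an empty left-hand side, which with parity 1 is ⊥. -/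
lemma subst_chain {ψ : XorConj V} (hbot : ¬ Derivable SubstRule ψ XorClause.bot)
    {x y : V} {p : ZMod 2}
    (h : ParityChain (fun x y p => x ≠ y ∧ Derivable SubstRule ψ ⟨{x, y}, p⟩) x y p) :
    (x = y → p = 0) ∧ (x ≠ y → Derivable SubstRule ψ ⟨{x, y}, p⟩) := by
  induction h with
  | nil => simp
  | @cons x y z p q h1 _ ih =>
    obtain ⟨hxy, h1⟩ := h1
    by_cases hyz : y = z
    · subst hyz
      rw [ih.1 rfl, add_zero]
      exact ⟨fun h => absurd h hxy, fun _ => h1⟩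
    have h2 := ih.2 hyz
    have h1' : Derivable SubstRule ψ ⟨{y, x}, p⟩ := by rwa [Finset.pair_comm]
    have h3 := h1'.subst_pair hxy.symm h2
    rw [XorClause.subst, if_pos (by simp), Finset.erase_insert (by simpa using hyz)] at h3
    refine ⟨?_, fun hxz => ?_⟩
    · rintro rfl
      by_contra hne
      have hqp : q + p = 1 := by
        revert hne; clear * -; revert p q; decide
      simp only [symmDiff_self, hqp] at h3
      exact hbot h3
    · have hsd : symmDiff ({z} : Finset V) {x} = {x, z} := by
        ext u
        simp only [Finset.mem_symmDiff, Finset.mem_singleton, Finset.mem_insert]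
        grind
      simp only [hsd] at h3
      rwa [add_comm]

theorem subst_saturated {ψ : XorConj V} (hbot : ¬ Derivable SubstRule ψ XorClause.bot) :
    Saturated (Derivable SubstRule ψ) where
  lit_unique x p q hp hq := by
    by_contra hne
    have h := hp.subst_lit hq
    rw [XorClause.subst, if_pos (by simp [XorClause.lit])] at h
    have hqp : q + p = 1 := by
      revert hne; clear * -; revert p q; decide
    simp only [XorClause.lit, hqp, Finset.erase_singleton, Finset.bot_eq_empty, symmDiff_self] at h
    exact hbot h
  unit2 x y p q hxy hp hq := by
    have h := hp.subst_lit hq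
    rw [XorClause.subst, if_pos (by simp), Finset.erase_insert (by simpa using hxy),
      ← Finset.bot_eq_empty, symmDiff_bot, add_comm] at h
    exact h
  unit3 x y z p q hxy hxz hyz hp hq := by
    have h := hp.subst_lit hq
    rw [XorClause.subst, if_pos (by simp), Finset.erase_insert (by simp [hxy, hxz]),
      ← Finset.bot_eq_empty, symmDiff_bot, add_comm] at h
    exact h
  chain_closed x p h := (subst_chain hbot h).1 rfl
  chain_imply x y z p q hxy hzx hzy hch hq := by
    have h := ((subst_chain hbot hch).2 hxy).subst_pair hxy hq
    rw [XorClause.subst, if_pos (by simp), Finset.erase_insert (by simp [hxy, hzx.symm]),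
      add_comm] at h
    have hsd : symmDiff ({y, z} : Finset V) {y} = {z} := by
      ext u
      simp only [Finset.mem_symmDiff, Finset.mem_singleton, Finset.mem_insert]
      grind
    simp only [hsd] at h
    exact h

/-! ### The system `EC` -/

/-- Puts a chain into the indexed form of the premises of `xorImply` and `xorConflict`. Those rules
only require consecutive variables to differ, so repetitions in the chain are harmless. -/
lemma ParityChain.exists_fin {V : Type*} {R : V → V → ZMod 2 → Prop} {a b : V} {s : ZMod 2}
    (h : ParityChain R a b s) :
    ∃ (n : ℕ) (x : Fin (n + 1) → V) (p : Fin n → ZMod 2), x 0 = a ∧ x (Fin.last n) = b ∧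
      ∑ i, p i = s ∧ ∀ i, R (x i.castSucc) (x i.succ) (p i) := by
  induction h with
  | nil a => exact ⟨0, fun _ => a, Fin.elim0, rfl, rfl, by simp, fun i => i.elim0⟩
  | @cons a b c p₀ q h1 _ ih =>
    obtain ⟨n, x, p, h0, hl, hs, hR⟩ := ih
    refine ⟨n + 1, Fin.cons a x, Fin.cons p₀ p, rfl, ?_, ?_, fun i => ?_⟩
    · rw [← Fin.succ_last, Fin.cons_succ, hl]
    · rw [Fin.sum_cons, hs]
    · induction i using Fin.cases with
      | zero => simpa [h0] using h1
      | succ i => simpa using hR i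

theorem ec_saturated {ψ : XorConj V} (hbot : ¬ Derivable ECRule ψ XorClause.bot) :
    Saturated (Derivable ECRule ψ) where
  lit_unique x p q hp hq := by
    by_contra hne
    have h : (p = 1 ∧ q = 0) ∨ (q = 1 ∧ p = 0) := by
      revert hne; clear * -; revert p q; decide
    rcases h with ⟨rfl, rfl⟩ | ⟨rfl, rfl⟩ <;>
    · refine hbot (.step (.conflict x) ?_)
      rintro E (rfl | rfl) <;> assumption
  unit2 x y p q hxy hp hq := by
    refine .step (.unit2 x y p q hxy) ?_
    rintro E (rfl | rfl) <;> assumption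
  unit3 x y z p q hxy hxz hyz hp hq := by
    refine .step (.unit3 x y z p q hxy hxz hyz) ?_
    rintro E (rfl | rfl) <;> assumption
  chain_closed a s h := by
    by_contra hne
    obtain ⟨n, x, p, h0, hl, hs, hR⟩ := h.exists_fin
    have hs1 : s = 1 := by
      revert hne; clear * -; revert s; decide
    rw [hs1] at hs
    cases n with
    | zero => simp at hs
    | succ n =>
      -- The last vertex of the closed chain repeats the first; once it is dropped, the cyclic
      -- successor reproduces the steps of the chain.
      have hrot : ∀ i : Fin (n + 1), x (finRotate (n + 1) i).castSucc = x i.succ := by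
        intro i
        induction i using Fin.lastCases with
        | last => rw [finRotate_last, Fin.castSucc_zero, h0, Fin.succ_last, hl]
        | cast i =>
          rw [finRotate_of_lt (by simp)]
          rfl
      refine hbot (.step (.xorConflict (n + 1) (fun i => x i.castSucc) p (fun i => ?_) hs) ?_)
      · rw [hrot]; exact (hR i).1
      · rintro E ⟨i, rfl⟩
        simp only [hrot]
        exact (hR i).2
  chain_imply a b z s q hab hza hzb h hq := by
    obtain ⟨n, x, p, rfl, rfl, rfl, hR⟩ := h.exists_fin
    refine .step (.xorImply n x p z q (fun i => (hR i).1) hab hza hzb) ?_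
    rintro E (rfl | ⟨i, rfl⟩)
    · exact hq
    · exact (hR i).2

end XorReasoning

theorem theorem2 {V : Type*} [DecidableEq V] (φ : XorReasoning.XorConj V)
    (h3 : XorReasoning.IsThreeXorNF φ) (hc : XorReasoning.IsCyclePartitionable φ) :
    XorReasoning.SubstDeducible φ ∧ XorReasoning.ECDeducible φ :=
  ⟨XorReasoning.deducible_of_saturated XorReasoning.substRule_sound
      (fun _ => XorReasoning.subst_saturated) h3.1 fun _ => hc.exists_cut h3.1,
    XorReasoning.deducible_of_saturated XorReasoning.ecRule_sound
      (fun _ => XorReasoning.ec_saturated) h3.1 fun _ => hc.exists_cut h3.1⟩
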